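/- **Setting.** For $p\in\mathbb R^3$ put $p^0=\sqrt{1+|p|^2}$. For $p,q\in\mathbb R^3$ let $s=(p^0+q^0)^2-|p+q|^2$, $g=\sqrt{|p-q|^2-(p^0-q^0)^2}$, $v_{\mathrm M}=\dfrac{g\sqrt s}{p^0q^0}$, $\gamma=\dfrac{p^0+q^0}{\sqrt s}$, and for $\omega\in\mathbb S^2$ $$p'=\tfrac{p+q}{2}+\tfrac g2\Big(\omega+(\gamma-1)(p+q)\tfrac{(p+q)\cdot\omega}{|p+q|^2}\Big),\qquad q'=\tfrac{p+q}{2}-\tfrac g2\Big(\omega+(\gamma-1)(p+q)\tfrac{(p+q)\cdot\omega}{|p+q|^2}\Big)$$ (the term with $\gamma-1$ is read as $0$ if $p+q=0$). The scattering angle $\theta\in[0,\pi]$ is given by $$\cos\theta=\frac{-(p^0-q^0)(p'^0-q'^0)+(p-q)\cdot(p'-q')}{g^2}\qquad(p\ne q).$$ Let $\Lambda\ge1$ and let the measurable scattering kernel $\sigma(g,\theta)$ satisfy $\Lambda^{-1}g\,\sigma_0(\theta)\le\sigma(g,\theta)\le\Lambda\, g\,\sigma_0(\theta)$ for $g\ge0$,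 $\theta\in[0,\pi]$, where $\sigma_0$ is measurable with $0\le\sigma_0\le\frac1{4\pi}$. For measurable $f:[0,1]\times\mathbb R^3\to[0,\infty)$ define $$Q^+(f,f)(x_1,p)=\int_{\mathbb R^3}\int_{\mathbb S^2}v_{\mathrm M}\,\sigma(g,\theta)\,f(x_1,p')\,f(x_1,q')\,d\omega\,dq\in[0,\infty],$$ where $d\omega$ is the surface measure on $\mathbb S^2$. For $k>0$ let $\varphi(p)=e^{kp^0}$, let $\|h(\cdot,p)\|_{L^\infty_{x_1}}=\operatorname{ess\,sup}_{x_1\in[0,1]}|h(x_1,p)|$, and let $$\|f\|=\int_{\mathbb R^3}\|f(\cdot,p)\|_{L^\infty_{x_1}}\,(p^0)^{1/2}\,\varphi(p)\,dp\in[0,\infty].$$ **Proposition.** There is a constant $C>0$, depending only on $\Lambda$, such that for all $\sigma,\sigma_0$ as above, all $k>0$, all measurable $f:[0,1]\times\mathbb R^3\to[0,\infty)$ and all $a\in\mathbb R^3$, $$\int_{\mathbb R^3}\frac{\varphi(p)}{|p-a|}\,\big\|Q^+(f,f)(\cdot,p)\big\|_{L^\infty_{x_1}}\,dp\;\le\;C\,\|f\|^2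 .$$ -/

import Mathlib

open MeasureTheory

noncomputable section

namespace RelBoltzmann

/-- Momentum space `ℝ³` with the Euclidean norm. -/
abbrev Momentum : Type := EuclideanSpace ℝ (Fin 3)

/-- The unit sphere `𝕊²` of scattering directions. -/
abbrev S2 : Type := Metric.sphere (0 : Momentum) 1

/-- The surface measure `dω` on `𝕊²` (total mass `4π`). -/
def surfaceMeasure : Measure S2 := (volume : Measure Momentum).toSphere

/-- The energy `p⁰ = √(1 + |p|²)`, with `c = m = 1`. -/
def energy (p : Momentum) : ℝ := Real.sqrt (1 + ‖p‖ ^ 2)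

/-- Lorentz product `-t t' + v · v'` of the four-vectors `(t, v)` and `(t', v')`. -/
def lorentz (t : ℝ) (v : Momentum) (t' : ℝ) (v' : Momentum) : ℝ :=
  -(t * t') + inner ℝ v v'

/-- `s = -(p^μ + q^μ)(p_μ + q_μ)`, the square of the energy in the center-of-momentum frame. -/
def sInv (p q : Momentum) : ℝ :=
  -lorentz (energy p + energy q) (p + q) (energy p + energy q) (p + q)

/-- The relative momentum `g = √((p^μ - q^μ)(p_μ - q_μ))`. -/
def relMom (p q : Momentum) : ℝ :=
  Real.sqrt (lorentz (energy p - energy q) (p - q) (energy p - energy q) (p - q))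

/-- The Møller velocity `g √s / (p⁰ q⁰)`. -/
def moller (p q : Momentum) : ℝ :=
  relMom p q * Real.sqrt (sInv p q) / (energy p * energy q)

/-- `γ = (p⁰ + q⁰) / √s`. -/
def gammaCM (p q : Momentum) : ℝ := (energy p + energy q) / Real.sqrt (sInv p q)

/-- `ω + (γ - 1)(p + q) ((p + q) · ω) / |p + q|²`, which is `ω` when `p + q = 0`. -/
def cmDir (p q : Momentum) (ω : S2) : Momentum :=
  (ω : Momentum) +
    ((gammaCM p q - 1) * (inner ℝ (p + q) (ω : Momentum) / ‖p + q‖ ^ 2)) • (p + q)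

/-- The post-collisional momentum `p'`. -/
def postP (p q : Momentum) (ω : S2) : Momentum :=
  (1 / 2 : ℝ) • (p + q) + (relMom p q / 2) • cmDir p q ω

/-- The post-collisional momentum `q'`. -/
def postQ (p q : Momentum) (ω : S2) : Momentum :=
  (1 / 2 : ℝ) • (p + q) - (relMom p q / 2) • cmDir p q ω

/-- The scattering angle `θ ∈ [0, π]`, `cos θ = (p^μ - q^μ)(p'_μ - q'_μ) / g²`.
(On the null set `p = q`, where the collision kernel vanishes, its value is irrelevant.) -/
def scatAngle (p q : Momentum) (ω : S2) : ℝ :=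
  Real.arccos
    (lorentz (energy p - energy q) (p - q)
        (energy (postP p q ω) - energy (postQ p q ω)) (postP p q ω - postQ p q ω)
      / relMom p q ^ 2)

/-- Hard-sphere type scattering kernels: `σ(g, θ) ≈ g σ₀(θ)` with comparison constant `Λ`, where
the angular part `σ₀` is measurable and `0 ≤ σ₀ ≤ 1 / (4π)`; in particular `σ₀` is integrable
on `𝕊²` with `∫ σ₀(θ) dω ≤ 1`. -/
structure IsHardSphereKernel (Λ : ℝ) (σ : ℝ → ℝ → ℝ) (σ₀ : ℝ → ℝ) : Prop where
  measurable_sigma : Measurable (Function.uncurry σ)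
  measurable_angular : Measurable σ₀
  angular_nonneg : ∀ θ ∈ Set.Icc 0 Real.pi, 0 ≤ σ₀ θ
  angular_le : ∀ θ ∈ Set.Icc 0 Real.pi, σ₀ θ ≤ 1 / (4 * Real.pi)
  lower : ∀ g, 0 ≤ g → ∀ θ ∈ Set.Icc 0 Real.pi, Λ⁻¹ * (g * σ₀ θ) ≤ σ g θ
  upper : ∀ g, 0 ≤ g → ∀ θ ∈ Set.Icc 0 Real.pi, σ g θ ≤ Λ * (g * σ₀ θ)

/-- The gain term `Q⁺(f, h)(x₁, p) = ∫_{ℝ³} ∫_{𝕊²} v_M σ(g, θ) f(x₁, p') h(x₁, q') dω dq`, for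
non-negative `f` and `h`, as a Lebesgue integral with values in `[0, ∞]`. -/
def gain (σ : ℝ → ℝ → ℝ) (f h : unitInterval → Momentum → ℝ)
    (x : unitInterval) (p : Momentum) : ENNReal :=
  ∫⁻ q : Momentum, ∫⁻ ω : S2,
    ENNReal.ofReal (moller p q * σ (relMom p q) (scatAngle p q ω)
      * f x (postP p q ω) * h x (postQ p q ω)) ∂surfaceMeasure

/-- The weight `φ(p) = exp (k p⁰)`. -/
def weight (k : ℝ) (p : Momentum) : ℝ := Real.exp (k * energy p)

/-- `‖f‖ = ∫ ess sup_{x₁ ∈ [0, 1]} |f(x₁, p)| (p⁰)^{1/2} φ(p) dp`, with values in `[0, ∞]`. -/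
def wnorm (k : ℝ) (f : unitInterval → Momentum → ℝ) : ENNReal :=
  ∫⁻ p : Momentum, essSup (fun x : unitInterval => ENNReal.ofReal |f x p|) volume
    * ENNReal.ofReal (Real.sqrt (energy p) * weight k p)

end RelBoltzmann

end

noncomputable section

namespace RelBoltzmann

open scoped RealInnerProductSpace

/-! Energy conservation gives `φ(p) ≤ φ(p') φ(q')`, and `σ ≤ Λ g / (4π)`, so with `G = ‖f(·,
p)‖_{L^∞} φ` everything reduces to `∫∫∫ |p - a|⁻¹ v_M g G(p') G(q') dω dq dp ≤ C (∫ G)²`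
(`lintegral_collision_le`).

Fix the total momentum `P = p + q` and write `p = cmMap P u`, with `u` the momentum in the
center-of-momentum frame. A collision replaces `u` by `|u| ω`, and the Jacobian times `v_M g` is `16
|u|² / T`, where the total energy `T` depends only on `P` and `|u|`. Hence the incoming and outgoing
directions may be exchanged (`lintegral_swap_direction`): `G` is then evaluated at the momenta given
by `u`, and only `|p' - a|⁻¹` is integrated over `ω`.

That integral is the Newtonian potential of an ellipsoid. The boost does not shrink distances, so
the potential is `O(1/|u|)` uniformly in `a` (`lintegral_inv_dist_cmMap_le`). The remaining factor
`|u| / T` is at most half the Jacobian (`norm_div_totalEnergy_le`); undoing the change of variables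
and integrating over `P` gives `(∫ G)²`. -/

theorem one_le_energy (p : Momentum) : 1 ≤ energy p :=
  Real.one_le_sqrt.2 (by nlinarith [sq_nonneg ‖p‖])

theorem energy_pos (p : Momentum) : 0 < energy p := one_pos.trans_le (one_le_energy p)

theorem energy_sq (p : Momentum) : energy p ^ 2 = 1 + ‖p‖ ^ 2 :=
  Real.sq_sqrt (by positivity)

theorem norm_lt_energy (p : Momentum) : ‖p‖ < energy p :=
  Real.lt_sqrt_of_sq_lt (by linarith)

theorem continuous_energy : Continuous energy := by unfold energy; fun_prop

/-! ### Center-of-momentum coordinates -/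

/-- The center-of-momentum energy `√s` of two particles with momenta `u` and `-u`. -/
def cmEnergy (u : Momentum) : ℝ := 2 * energy u

/-- The energy of a pair of total momentum `P` whose relative momentum in the center-of-momentum
frame is `u`. -/
def totalEnergy (P u : Momentum) : ℝ := Real.sqrt (cmEnergy u ^ 2 + ‖P‖ ^ 2)

/-- `(γ - 1) / |P|²`, in a form without singularity at `P = 0`. -/
def boostCoeff (P u : Momentum) : ℝ :=
  1 / (cmEnergy u * (totalEnergy P u + cmEnergy u))

/-- The linear map `v ↦ v + (γ - 1) (P · v) P / |P|²`. -/
def boost (P u v : Momentum) : Momentum := v + (boostCoeff P u * inner ℝ P v) • P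

/-- The momentum, in the original frame, of the particle which has momentum `u` in the
center-of-momentum frame of a pair with total momentum `P`. -/
def cmMap (P u : Momentum) : Momentum := (1 / 2 : ℝ) • P + boost P u u

theorem cmEnergy_pos (u : Momentum) : 0 < cmEnergy u := mul_pos two_pos (energy_pos u)

theorem cmEnergy_sq (u : Momentum) : cmEnergy u ^ 2 = 4 * (1 + ‖u‖ ^ 2) := by
  rw [cmEnergy, mul_pow, energy_sq]; norm_num

theorem totalEnergy_sq (P u : Momentum) :
    totalEnergy P u ^ 2 = cmEnergy u ^ 2 + ‖P‖ ^ 2 := Real.sq_sqrt (by positivity)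

theorem totalEnergy_pos (P u : Momentum) : 0 < totalEnergy P u :=
  Real.sqrt_pos.2 (by have := cmEnergy_pos u; positivity)

theorem cmEnergy_congr {u v : Momentum} (h : ‖u‖ = ‖v‖) : cmEnergy u = cmEnergy v := by
  simp only [cmEnergy, energy, h]

theorem totalEnergy_congr (P : Momentum) {u v : Momentum} (h : ‖u‖ = ‖v‖) :
    totalEnergy P u = totalEnergy P v := by
  simp only [totalEnergy, cmEnergy_congr h]

theorem boostCoeff_congr (P : Momentum) {u v : Momentum} (h : ‖u‖ = ‖v‖) :
    boostCoeff P u = boostCoeff P v := by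
  simp only [boostCoeff, cmEnergy_congr h, totalEnergy_congr P h]

/-- The boost sees `u` only through `|u|`, so `u`, `-u` and `|u| ω` are all transformed by one
linear map. -/
theorem boost_congr (P : Momentum) {u v : Momentum} (h : ‖u‖ = ‖v‖) : boost P u = boost P v := by
  ext1 w
  simp only [boost, boostCoeff_congr P h]

theorem boostCoeff_mul_norm_sq (P u : Momentum) :
    boostCoeff P u * ‖P‖ ^ 2 = totalEnergy P u / cmEnergy u - 1 := by
  have hE := cmEnergy_pos u
  have hT := totalEnergy_pos P u
  have h : ‖P‖ ^ 2 = (totalEnergy P u - cmEnergy u) * (totalEnergy P u + cmEnergy u) := by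
    linarith [totalEnergy_sq P u]
  rw [h, boostCoeff]
  field_simp

theorem inner_boost (P u v : Momentum) :
    inner ℝ P (boost P u v) = totalEnergy P u / cmEnergy u * inner ℝ P v := by
  rw [boost, inner_add_right, real_inner_smul_right, real_inner_self_eq_norm_sq]
  linear_combination inner ℝ P v * boostCoeff_mul_norm_sq P u

theorem boostCoeff_quadratic (P u : Momentum) :
    2 * boostCoeff P u + boostCoeff P u ^ 2 * ‖P‖ ^ 2 = 1 / cmEnergy u ^ 2 := by
  have hE := cmEnergy_pos u
  have hT := totalEnergy_pos P u
  have h : 2 * boostCoeff P u + boostCoeff P u ^ 2 * ‖P‖ ^ 2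
      = boostCoeff P u * (totalEnergy P u / cmEnergy u + 1) := by
    linear_combination boostCoeff P u * boostCoeff_mul_norm_sq P u
  rw [h, boostCoeff]
  field_simp

theorem norm_boost_sq (P u v : Momentum) :
    ‖boost P u v‖ ^ 2 = ‖v‖ ^ 2 + (inner ℝ P v / cmEnergy u) ^ 2 := by
  rw [boost, norm_add_sq_real, real_inner_smul_right, norm_smul, mul_pow, Real.norm_eq_abs, sq_abs,
    real_inner_comm P v]
  have := boostCoeff_quadratic P u
  rw [div_pow, div_eq_mul_one_div (_ ^ 2), ← this]
  ring

/-- The partner particle has the opposite momentum in the center-of-momentum frame. -/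
theorem cmMap_neg (P u : Momentum) : cmMap P (-u) = P - cmMap P u := by
  have h : boost P (-u) = boost P u := boost_congr P (norm_neg u)
  simp only [cmMap, h]
  simp only [boost, inner_neg_right]
  module

theorem energy_cmMap (P u : Momentum) :
    energy (cmMap P u) = totalEnergy P u / 2 + inner ℝ P u / cmEnergy u := by
  have hE := cmEnergy_pos u
  have hT := totalEnergy_pos P u
  have hu : ‖u‖ ≤ cmEnergy u / 2 := by rw [cmEnergy]; linarith [norm_lt_energy u]
  have hP : ‖P‖ ≤ totalEnergy P u := Real.le_sqrt_of_sq_le (by nlinarith)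
  have hPu : -(‖P‖ * ‖u‖) ≤ inner ℝ P u := neg_le_of_abs_le (abs_real_inner_le_norm P u)
  -- Squares determine the energy only up to sign; nonnegativity follows from `|P| ≤ T` and `|u| ≤ E
  -- / 2`.
  have h0 : 0 ≤ totalEnergy P u / 2 + inner ℝ P u / cmEnergy u := by
    have : -(totalEnergy P u * (cmEnergy u / 2)) ≤ inner ℝ P u :=
      (neg_le_neg (mul_le_mul hP hu (norm_nonneg _) hT.le)).trans hPu
    have h2 := div_le_div_of_nonneg_right this hE.le
    have h3 : -(totalEnergy P u * (cmEnergy u / 2)) / cmEnergy u = - (totalEnergy P u / 2) := by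
      field_simp
    linarith
  have h1 : ‖(1 / 2 : ℝ) • P + boost P u u‖ ^ 2
      = ‖P‖ ^ 2 / 4 + totalEnergy P u / cmEnergy u * inner ℝ P u
        + (‖u‖ ^ 2 + (inner ℝ P u / cmEnergy u) ^ 2) := by
    rw [norm_add_sq_real, norm_smul, mul_pow, real_inner_smul_left, inner_boost, norm_boost_sq]
    norm_num
    ring
  rw [energy, ← Real.sqrt_sq h0, cmMap, h1]
  congr 1
  linear_combination (-1 / 4 : ℝ) * cmEnergy_sq u - (1 / 4 : ℝ) * totalEnergy_sq P u

theorem energy_sub_cmMap (P u : Momentum) :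
    energy (P - cmMap P u) = totalEnergy P u / 2 - inner ℝ P u / cmEnergy u := by
  rw [← cmMap_neg, energy_cmMap, totalEnergy_congr P (norm_neg u), cmEnergy_congr (norm_neg u),
    inner_neg_right]
  ring

theorem energy_add_energy_cmMap (P u : Momentum) :
    energy (cmMap P u) + energy (P - cmMap P u) = totalEnergy P u := by
  rw [energy_cmMap, energy_sub_cmMap]
  ring

/-- The image determines the total energy, hence `|u|`, hence the linear boost; pairing with `P`
then recovers `P · u` and finally `u`. -/
theorem cmMap_injective (P : Momentum) : Function.Injective (cmMap P) := by
  intro u v h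
  have hT : totalEnergy P u = totalEnergy P v := by
    rw [← energy_add_energy_cmMap, h, energy_add_energy_cmMap]
  have hn : ‖u‖ = ‖v‖ := by
    have h1 := totalEnergy_sq P u
    rw [hT, totalEnergy_sq, cmEnergy_sq, cmEnergy_sq] at h1
    have h2 : ‖u‖ ^ 2 = ‖v‖ ^ 2 := by linarith
    exact (sq_eq_sq₀ (norm_nonneg _) (norm_nonneg _)).1 h2
  have hb : boost P v u = boost P v v := by
    have := add_left_cancel h
    rwa [boost_congr P hn] at this
  have hi : inner ℝ P u = inner ℝ P v := by
    have := congrArg (inner ℝ P) hb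
    rw [inner_boost, inner_boost] at this
    exact mul_left_cancel₀ (div_pos (totalEnergy_pos P v) (cmEnergy_pos v)).ne' this
  rw [boost, boost, hi] at hb
  exact add_right_cancel hb

theorem cmMap_surjective (P : Momentum) : Function.Surjective (cmMap P) := by
  intro p
  obtain ⟨q, rfl⟩ : ∃ q, P = p + q := ⟨P - p, by abel⟩
  set P := p + q with hPdef
  have hp := energy_sq p
  have hq := energy_sq q
  set T := energy p + energy q with hTdef
  have hT : 0 < T := add_pos (energy_pos p) (energy_pos q)
  have hlt : ‖P‖ < T :=
    (norm_add_le p q).trans_lt (add_lt_add (norm_lt_energy p) (norm_lt_energy q))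
  have hpos : 0 < T ^ 2 - ‖P‖ ^ 2 := by nlinarith [norm_nonneg P]
  set E := Real.sqrt (T ^ 2 - ‖P‖ ^ 2) with hEdef
  have hE : 0 < E := Real.sqrt_pos.2 hpos
  have hE2 : E ^ 2 = T ^ 2 - ‖P‖ ^ 2 := Real.sq_sqrt hpos.le
  have hP2 : ‖P‖ ^ 2 = (T - E) * (T + E) := by linarith
  have hpq : ‖P‖ ^ 2 = ‖p‖ ^ 2 + 2 * inner ℝ p q + ‖q‖ ^ 2 := norm_add_sq_real p q
  obtain ⟨v, hv⟩ : ∃ v, v = (1 / 2 : ℝ) • (p - q) := ⟨_, rfl⟩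
  have hv2 : ‖v‖ ^ 2 = (‖p‖ ^ 2 - 2 * inner ℝ p q + ‖q‖ ^ 2) / 4 := by
    rw [hv, norm_smul, mul_pow, norm_sub_sq_real]
    norm_num
    ring
  have hPv : inner ℝ P v = (energy p - energy q) * T / 2 := by
    rw [hv, hPdef, real_inner_smul_right, inner_add_left, inner_sub_right, inner_sub_right,
      real_inner_self_eq_norm_sq, real_inner_self_eq_norm_sq, real_inner_comm p q]
    linear_combination (-1 / 2 : ℝ) * hp + (1 / 2 : ℝ) * hq
  -- The inverse boost contracts the `P` direction: `c |P|² = 1 - E / T = 1 - 1 / γ`.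
  set c := 1 / (T * (T + E)) with hc
  have hcP : c * ‖P‖ ^ 2 = (T - E) / T := by
    rw [hP2, hc]
    field_simp
  set u := v - (c * inner ℝ P v) • P with hu
  have hu2 : ‖u‖ ^ 2 = ‖v‖ ^ 2 - (energy p - energy q) ^ 2 / 4 := by
    have h1 : ‖u‖ ^ 2 = ‖v‖ ^ 2 - (inner ℝ P v) ^ 2 * (2 * c - c * (c * ‖P‖ ^ 2)) := by
      rw [hu, norm_sub_sq_real, real_inner_smul_right, norm_smul, mul_pow, Real.norm_eq_abs, sq_abs,
        real_inner_comm P v]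
      ring
    rw [h1, hcP, hPv, hc]
    field_simp
    ring
  have hEu : cmEnergy u = E := by
    rw [← sq_eq_sq₀ (cmEnergy_pos u).le hE.le, cmEnergy_sq, hu2, hE2, hv2, hpq]
    linear_combination -2 * hp - 2 * hq
  have hTu : totalEnergy P u = T := by
    rw [totalEnergy, hEu, hE2, sub_add_cancel, Real.sqrt_sq hT.le]
  have hPu : inner ℝ P u = E / T * inner ℝ P v := by
    rw [hu, inner_sub_right, real_inner_smul_right, real_inner_self_eq_norm_sq]
    have : E / T = 1 - c * ‖P‖ ^ 2 := by rw [hcP]; field_simp; ring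
    rw [this]
    ring
  refine ⟨u, ?_⟩
  have hbc : boostCoeff P u * inner ℝ P u = c * inner ℝ P v := by
    rw [hPu, boostCoeff, hEu, hTu, hc]
    field_simp
  rw [cmMap, boost, hbc, hu, sub_add_cancel, hv, hPdef]
  module

/-! ### Collisions in center-of-momentum coordinates -/

theorem sInv_cmMap (P u : Momentum) : sInv (cmMap P u) (P - cmMap P u) = cmEnergy u ^ 2 := by
  rw [sInv, lorentz, energy_add_energy_cmMap, add_sub_cancel, real_inner_self_eq_norm_sq]
  linear_combination totalEnergy_sq P u

theorem relMom_cmMap (P u : Momentum) : relMom (cmMap P u) (P - cmMap P u) = 2 * ‖u‖ := by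
  have h : cmMap P u - (P - cmMap P u) = (2 : ℝ) • boost P u u := by
    rw [cmMap]; module
  rw [relMom, lorentz, energy_cmMap, energy_sub_cmMap, h, real_inner_self_eq_norm_sq, norm_smul,
    mul_pow, norm_boost_sq, ← Real.sqrt_sq (mul_nonneg zero_le_two (norm_nonneg u))]
  congr 1
  norm_num
  ring

theorem gammaCM_cmMap (P u : Momentum) :
    gammaCM (cmMap P u) (P - cmMap P u) = totalEnergy P u / cmEnergy u := by
  rw [gammaCM, energy_add_energy_cmMap, sInv_cmMap, Real.sqrt_sq (cmEnergy_pos u).le]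

theorem cmDir_cmMap (P u : Momentum) (ω : S2) :
    cmDir (cmMap P u) (P - cmMap P u) ω = boost P u ω := by
  rw [cmDir, gammaCM_cmMap, add_sub_cancel, boost, ← boostCoeff_mul_norm_sq]
  rcases eq_or_ne P 0 with rfl | hP
  · simp
  · have : ‖P‖ ≠ 0 := norm_ne_zero_iff.2 hP
    congr 2
    field_simp

theorem boost_smul (P u v : Momentum) (r : ℝ) : boost P u (r • v) = r • boost P u v := by
  simp only [boost, real_inner_smul_right]
  module

theorem cmMap_norm_smul (P u : Momentum) (ω : S2) :
    cmMap P (‖u‖ • (ω : Momentum)) = (1 / 2 : ℝ) • P + ‖u‖ • boost P u ω := by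
  have h : ‖‖u‖ • (ω : Momentum)‖ = ‖u‖ := by simp [norm_smul]
  rw [cmMap, boost_congr P h, boost_smul]

theorem postP_cmMap (P u : Momentum) (ω : S2) :
    postP (cmMap P u) (P - cmMap P u) ω = cmMap P (‖u‖ • (ω : Momentum)) := by
  rw [postP, cmDir_cmMap, relMom_cmMap, add_sub_cancel, mul_div_cancel_left₀ _ two_ne_zero,
    cmMap_norm_smul]

theorem postQ_cmMap (P u : Momentum) (ω : S2) :
    postQ (cmMap P u) (P - cmMap P u) ω = P - cmMap P (‖u‖ • (ω : Momentum)) := by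
  rw [postQ, cmDir_cmMap, relMom_cmMap, add_sub_cancel, mul_div_cancel_left₀ _ two_ne_zero,
    cmMap_norm_smul]
  module

/-- A collision only rotates `u` to `|u| ω`, and the total energy depends on `P` and `|u|` alone. -/
theorem energy_post (p q : Momentum) (ω : S2) :
    energy (postP p q ω) + energy (postQ p q ω) = energy p + energy q := by
  obtain ⟨P, rfl⟩ : ∃ P, q = P - p := ⟨p + q, by abel⟩
  obtain ⟨u, rfl⟩ := cmMap_surjective P p
  rw [postP_cmMap, postQ_cmMap, energy_add_energy_cmMap, energy_add_energy_cmMap]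
  exact totalEnergy_congr P (by simp [norm_smul])

/-! ### Jacobian and change of variables -/

/-- The Jacobian determinant of `cmMap P`. -/
def cmJacobian (P u : Momentum) : ℝ :=
  4 * (energy (cmMap P u) * energy (P - cmMap P u)) / (cmEnergy u * totalEnergy P u)

theorem cmJacobian_pos (P u : Momentum) : 0 < cmJacobian P u := by
  have := cmEnergy_pos u
  have := totalEnergy_pos P u
  have := energy_pos (cmMap P u)
  have := energy_pos (P - cmMap P u)
  unfold cmJacobian
  positivity

/-- The coefficient is a function of `m = |u|²`, with `dE/dm = 2/E` and `dT/dm = 2/T`; this gives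
`-2 / (E³ T)` in `m`, and the gradient `2u` of `|u|²` supplies the other factor 2. -/
theorem hasFDerivAt_boostCoeff (P u : Momentum) :
    HasFDerivAt (boostCoeff P)
      ((-4 / (cmEnergy u ^ 3 * totalEnergy P u)) • innerSL ℝ u) u := by
  let e : ℝ → ℝ := fun m => 2 * Real.sqrt (1 + m)
  let t : ℝ → ℝ := fun m => Real.sqrt (e m ^ 2 + ‖P‖ ^ 2)
  have hepos : 0 < e (‖u‖ ^ 2) := cmEnergy_pos u
  have htpos : 0 < t (‖u‖ ^ 2) := totalEnergy_pos P u
  have he : HasDerivAt e (2 / e (‖u‖ ^ 2)) (‖u‖ ^ 2) := by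
    have hne : (1 + id (‖u‖ ^ 2) : ℝ) ≠ 0 := by simp only [id]; positivity
    refine ((((hasDerivAt_id (‖u‖ ^ 2)).const_add 1).sqrt hne).const_mul 2).congr_deriv ?_
    simp only [e, id]
    field_simp
  have ht : HasDerivAt t (2 / t (‖u‖ ^ 2)) (‖u‖ ^ 2) := by
    have hne : ((e ^ 2) (‖u‖ ^ 2) + ‖P‖ ^ 2 : ℝ) ≠ 0 := by simp only [Pi.pow_apply]; positivity
    refine (((he.pow 2).add_const (‖P‖ ^ 2)).sqrt hne).congr_deriv ?_
    change _ / (2 * t (‖u‖ ^ 2)) = _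
    field_simp
    norm_num
  have hk : HasDerivAt (fun m => 1 / (e m * (t m + e m)))
      (-2 / (e (‖u‖ ^ 2) ^ 3 * t (‖u‖ ^ 2))) (‖u‖ ^ 2) := by
    have h := (he.mul (ht.add he)).inv (mul_pos hepos (add_pos htpos hepos)).ne'
    simp only [one_div]
    refine h.congr_deriv ?_
    simp only [Pi.mul_apply, Pi.add_apply]
    field_simp
    ring
  refine (hk.comp_hasFDerivAt u (hasStrictFDerivAt_norm_sq u).hasFDerivAt).congr_fderiv ?_
  change _ = (-4 / (e (‖u‖ ^ 2) ^ 3 * t (‖u‖ ^ 2))) • innerSL ℝ u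
  rw [← Nat.cast_smul_eq_nsmul ℝ, smul_smul]
  congr 1
  push_cast
  ring

theorem hasFDerivAt_cmMap (P u : Momentum) :
    HasFDerivAt (cmMap P) (ContinuousLinearMap.id ℝ Momentum +
      (boostCoeff P u • innerSL ℝ P + (inner ℝ P u : ℝ) •
        ((-4 / (cmEnergy u ^ 3 * totalEnergy P u)) • innerSL ℝ u)).smulRight P) u := by
  have h1 : HasFDerivAt (fun u : Momentum => (inner ℝ P u : ℝ)) (innerSL ℝ P) u :=
    (innerSL ℝ P).hasFDerivAt
  exact (((hasFDerivAt_boostCoeff P u).mul h1).smul_const P |> (hasFDerivAt_id u).add).const_add _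

/-- The derivative is a rank-one perturbation of the identity, with determinant `1 + L P = T/E - 4
(P · u)² / (E³ T)`; the formulas for the two energies factor this as the Jacobian. -/
theorem det_fderiv_cmMap (P u : Momentum) :
    (ContinuousLinearMap.id ℝ Momentum +
      (boostCoeff P u • innerSL ℝ P + (inner ℝ P u : ℝ) •
        ((-4 / (cmEnergy u ^ 3 * totalEnergy P u)) • innerSL ℝ u)).smulRight P).det
      = cmJacobian P u := by
  set L := boostCoeff P u • innerSL ℝ P + (inner ℝ P u : ℝ) •
        ((-4 / (cmEnergy u ^ 3 * totalEnergy P u)) • innerSL ℝ u) with hL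
  have h := LinearMap.transvection.det (L : Momentum →ₗ[ℝ] ℝ) P
  have h2 : (L : Momentum →ₗ[ℝ] ℝ) P = boostCoeff P u * ‖P‖ ^ 2
      + inner ℝ P u * (-4 / (cmEnergy u ^ 3 * totalEnergy P u) * inner ℝ P u) := by
    simp [hL, real_inner_comm P u]
  have hE := cmEnergy_pos u
  have hT := totalEnergy_pos P u
  have h3 : 1 + (L : Momentum →ₗ[ℝ] ℝ) P = cmJacobian P u := by
    rw [h2, boostCoeff_mul_norm_sq, cmJacobian, energy_cmMap, energy_sub_cmMap]
    field_simp
    ring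
  rw [← h3, ← h]
  rfl

/-- Change of variables from the momentum `p` to the center-of-momentum variable `u`. -/
theorem lintegral_cmMap (P : Momentum) (h : Momentum → ENNReal) :
    ∫⁻ p, h p = ∫⁻ u, ENNReal.ofReal (cmJacobian P u) * h (cmMap P u) := by
  have := lintegral_image_eq_lintegral_abs_det_fderiv_mul (volume : Measure Momentum)
    MeasurableSet.univ (fun u _ => (hasFDerivAt_cmMap P u).hasFDerivWithinAt)
    (cmMap_injective P).injOn h
  simpa only [Set.image_univ, (cmMap_surjective P).range_eq, Measure.restrict_univ,
    det_fderiv_cmMap, abs_of_pos (cmJacobian_pos P _)] using this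

/-- In the center-of-momentum variable the collision kernel depends on `|u|` only. -/
theorem cmJacobian_mul_moller (P u : Momentum) :
    cmJacobian P u * (moller (cmMap P u) (P - cmMap P u) * relMom (cmMap P u) (P - cmMap P u))
      = 16 * ‖u‖ ^ 2 / totalEnergy P u := by
  have := cmEnergy_pos u
  have := totalEnergy_pos P u
  have := energy_pos (cmMap P u)
  have := energy_pos (P - cmMap P u)
  rw [moller, cmJacobian, relMom_cmMap, sInv_cmMap, Real.sqrt_sq (cmEnergy_pos u).le]
  field_simp
  ring

theorem moller_nonneg (p q : Momentum) : 0 ≤ moller p q := by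
  have := energy_pos p
  have := energy_pos q
  unfold moller relMom
  positivity

/-- With `|u| ≤ E / 2`, the claim reduces to `E² = s ≤ 4 p⁰ q⁰`, which follows from `1 + |p||q| ≤ p⁰
q⁰`. -/
theorem norm_div_totalEnergy_le (P u : Momentum) :
    ‖u‖ / totalEnergy P u ≤ cmJacobian P u / 2 := by
  have hE := cmEnergy_pos u
  have hT := totalEnergy_pos P u
  have hp := energy_pos (cmMap P u)
  have hq := energy_pos (P - cmMap P u)
  have hu : ‖u‖ ≤ cmEnergy u / 2 := by rw [cmEnergy]; linarith [norm_lt_energy u]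
  have hs : cmEnergy u ^ 2 ≤ 4 * (energy (cmMap P u) * energy (P - cmMap P u)) := by
    rw [← sInv_cmMap P u]
    set p := cmMap P u
    set q := P - p
    have h1 := energy_sq p
    have h2 := energy_sq q
    have h3 : -(‖p‖ * ‖q‖) ≤ inner ℝ p q := neg_le_of_abs_le (abs_real_inner_le_norm p q)
    have h4 : 1 + ‖p‖ * ‖q‖ ≤ energy p * energy q := by
      refine le_of_sq_le_sq ?_ (by positivity)
      rw [mul_pow, h1, h2]
      nlinarith [sq_nonneg (‖p‖ - ‖q‖)]
    rw [sInv, lorentz, real_inner_self_eq_norm_sq, norm_add_sq_real]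
    nlinarith
  rw [cmJacobian, div_le_iff₀ hT]
  have : 4 * (energy (cmMap P u) * energy (P - cmMap P u)) / (cmEnergy u * totalEnergy P u) / 2
      * totalEnergy P u = 4 * (energy (cmMap P u) * energy (P - cmMap P u)) / cmEnergy u / 2 := by
    field_simp
  rw [this]
  have h5 : cmEnergy u ≤ 4 * (energy (cmMap P u) * energy (P - cmMap P u)) / cmEnergy u := by
    rw [le_div_iff₀ hE]; nlinarith
  linarith

/-! ### Newtonian potential of the unit sphere -/

open Set
open scoped Pointwise

instance : IsFiniteMeasure surfaceMeasure := by unfold surfaceMeasure; infer_instance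

theorem surfaceMeasure_univ : surfaceMeasure univ = ENNReal.ofReal (4 * Real.pi) := by
  rw [surfaceMeasure, Measure.toSphere_apply_univ, EuclideanSpace.volume_ball_fin_three,
    finrank_euclideanSpace, Fintype.card_fin, ← ENNReal.ofReal_natCast,
    ENNReal.ofReal_one, one_pow, one_mul, ← ENNReal.ofReal_mul (by positivity)]
  congr 1
  push_cast
  ring

/-- A cap of radius `ε` of the unit sphere has area `O(ε²)`: the cone over it is covered by
`O(1 / ε)` balls of radius `3 ε`. -/
theorem surfaceMeasure_cap_le (b : Momentum) {ε : ℝ} (hε : 0 < ε) (hε1 : ε ≤ 1) :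
    surfaceMeasure {ω : S2 | ‖(ω : Momentum) - b‖ < ε}
      ≤ ENNReal.ofReal (216 * Real.pi * ε ^ 2) := by
  set s := {ω : S2 | ‖(ω : Momentum) - b‖ < ε} with hs
  rcases s.eq_empty_or_nonempty with h | ⟨ω₀, hω₀⟩
  · simp [h]
  have hmeas : MeasurableSet s := by
    rw [hs]; exact measurableSet_lt (by fun_prop) measurable_const
  set N := ⌊1 / ε⌋₊ + 1 with hN
  have hNle : (N : ℝ) ≤ 2 / ε := by
    have h1 : (⌊1 / ε⌋₊ : ℝ) ≤ 1 / ε := Nat.floor_le (by positivity)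
    have h2 : 1 ≤ 1 / ε := (one_le_div hε).2 hε1
    have h3 : 2 / ε = 1 / ε + 1 / ε := by ring
    rw [hN]; push_cast; linarith
  -- Centers are spaced by `ε` along the ray through one point `ω₀` of the cap: the radial error is
  -- at most `ε` and the angular one below `2ε`.
  have hsub : Ioo (0 : ℝ) 1 • ((↑) '' s : Set Momentum)
      ⊆ ⋃ j ∈ Finset.range N, Metric.ball ((j * ε : ℝ) • (ω₀ : Momentum)) (3 * ε) := by
    rintro _ ⟨t, ht, _, ⟨ω, hω, rfl⟩, rfl⟩
    have hω' : ‖(ω : Momentum) - b‖ < ε := hω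
    have hω₀' : ‖(ω₀ : Momentum) - b‖ < ε := hω₀
    have hn : ‖(ω₀ : Momentum)‖ = 1 := norm_eq_of_mem_sphere ω₀
    have h1 : ‖(ω : Momentum) - ω₀‖ < 2 * ε := by
      have h : (ω : Momentum) - ω₀ = (ω - b) - (ω₀ - b) := by abel
      rw [h]
      linarith [norm_sub_le ((ω : Momentum) - b) (ω₀ - b)]
    have hj1 : (⌊t / ε⌋₊ : ℝ) * ε ≤ t := by
      rw [← le_div_iff₀ hε]; exact Nat.floor_le (by have := ht.1; positivity)
    have hj2 : t < (⌊t / ε⌋₊ + 1 : ℝ) * ε := by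
      rw [← div_lt_iff₀ hε]; exact Nat.lt_floor_add_one _
    simp only [mem_iUnion, Finset.mem_range]
    refine ⟨⌊t / ε⌋₊, Nat.lt_succ_of_le (Nat.floor_mono (by gcongr; exact ht.2.le)), ?_⟩
    rw [mem_ball_iff_norm]
    have h : t • (ω : Momentum) - (⌊t / ε⌋₊ * ε : ℝ) • (ω₀ : Momentum)
        = t • ((ω : Momentum) - ω₀) + (t - ⌊t / ε⌋₊ * ε) • (ω₀ : Momentum) := by module
    change ‖t • (ω : Momentum) - _‖ < _
    rw [h]
    refine (norm_add_le _ _).trans_lt ?_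
    rw [norm_smul, norm_smul, hn, Real.norm_of_nonneg ht.1.le, Real.norm_of_nonneg (by linarith)]
    nlinarith [ht.1, ht.2, norm_nonneg ((ω : Momentum) - ω₀)]
  -- The area of the cap is three times the volume of the cone over it.
  rw [surfaceMeasure, Measure.toSphere_apply' _ hmeas, finrank_euclideanSpace, Fintype.card_fin]
  have hvol : volume (Ioo (0 : ℝ) 1 • ((↑) '' s : Set Momentum))
      ≤ ENNReal.ofReal (N * ((3 * ε) ^ 3 * (Real.pi * 4 / 3))) := by
    refine (measure_mono hsub).trans ((measure_biUnion_finset_le _ _).trans ?_)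
    simp only [EuclideanSpace.volume_ball_fin_three, Finset.sum_const, Finset.card_range,
      nsmul_eq_mul]
    rw [← ENNReal.ofReal_pow (by positivity), ← ENNReal.ofReal_mul (by positivity),
      ← ENNReal.ofReal_natCast, ← ENNReal.ofReal_mul (by positivity)]
  refine (mul_le_mul_right hvol _).trans ?_
  rw [← ENNReal.ofReal_natCast, ← ENNReal.ofReal_mul (by positivity)]
  apply ENNReal.ofReal_le_ofReal
  calc ((3 : ℕ) : ℝ) * (N * ((3 * ε) ^ 3 * (Real.pi * 4 / 3)))
      ≤ ((3 : ℕ) : ℝ) * (2 / ε * ((3 * ε) ^ 3 * (Real.pi * 4 / 3))) := by gcongr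
    _ = 216 * Real.pi * ε ^ 2 := by field_simp; norm_num

/-- The Newtonian potential of the unit sphere is bounded. -/
theorem lintegral_sphere_inv_dist_le (b : Momentum) :
    ∫⁻ ω : S2, ENNReal.ofReal (1 / ‖(ω : Momentum) - b‖) ∂surfaceMeasure
      ≤ ENNReal.ofReal (220 * Real.pi) := by
  -- Layer-cake formula: levels `t ≤ 1` contribute at most the full area `4π`; for `t > 1` the
  -- superlevel set lies in a cap of radius `1/t`, and `∫₁^∞ 216π t⁻² dt = 216π`.
  rw [lintegral_eq_lintegral_meas_lt _ (Filter.Eventually.of_forall fun ω => by positivity)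
    (by fun_prop), ← Ioc_union_Ioi_eq_Ioi zero_le_one,
    lintegral_union measurableSet_Ioi (Ioc_disjoint_Ioi le_rfl)]
  have h1 : ∫⁻ t in Ioc (0 : ℝ) 1, surfaceMeasure {ω : S2 | t < 1 / ‖(ω : Momentum) - b‖}
      ≤ ENNReal.ofReal (4 * Real.pi) := by
    refine (lintegral_mono fun t => measure_mono (subset_univ _)).trans ?_
    simp [surfaceMeasure_univ]
  have h2 : ∫⁻ t in Ioi (1 : ℝ), surfaceMeasure {ω : S2 | t < 1 / ‖(ω : Momentum) - b‖}
      ≤ ENNReal.ofReal (216 * Real.pi) := by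
    have h3 : ∫⁻ t in Ioi (1 : ℝ), ENNReal.ofReal (216 * Real.pi * t ^ (-2 : ℝ))
        = ENNReal.ofReal (216 * Real.pi) := by
      rw [← ofReal_integral_eq_lintegral_ofReal
        ((integrableOn_Ioi_rpow_of_lt (by norm_num) one_pos).const_mul _)
        (by
          filter_upwards [ae_restrict_mem measurableSet_Ioi] with t ht
          have : (0 : ℝ) < t := one_pos.trans ht
          positivity),
        integral_const_mul, integral_Ioi_rpow_of_lt (by norm_num) one_pos]
      norm_num
    rw [← h3]
    refine setLIntegral_mono' measurableSet_Ioi fun t ht => ?_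
    have ht0 : (0 : ℝ) < t := one_pos.trans ht
    have h4 : (216 * Real.pi * t ^ (-2 : ℝ)) = 216 * Real.pi * (1 / t) ^ 2 := by
      rw [Real.rpow_neg ht0.le]; norm_num
    rw [h4]
    refine (measure_mono fun ω hω => ?_).trans (surfaceMeasure_cap_le b (one_div_pos.2 ht0)
      ((div_le_one ht0).2 (le_of_lt ht)))
    have hω' : t < 1 / ‖(ω : Momentum) - b‖ := hω
    have h5 : 0 < ‖(ω : Momentum) - b‖ := one_div_pos.1 (ht0.trans hω')
    exact (lt_one_div ht0 h5).1 hω'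
  refine (add_le_add h1 h2).trans_eq ?_
  rw [← ENNReal.ofReal_add (by positivity) (by positivity)]
  congr 1
  ring

/-! ### Polar coordinates and exchange of directions -/

theorem lintegral_polar (f : Momentum → ENNReal) :
    ∫⁻ u, f u = ∫⁻ z : S2 × Ioi (0 : ℝ), f ((z.2 : ℝ) • (z.1 : Momentum))
      ∂(surfaceMeasure.prod (Measure.volumeIoiPow 2)) := by
  have h := (volume : Measure Momentum).measurePreserving_homeomorphUnitSphereProd.lintegral_comp_emb
    (Homeomorph.measurableEmbedding _) (fun z => f ((z.2 : ℝ) • (z.1 : Momentum)))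
  rw [finrank_euclideanSpace, Fintype.card_fin] at h
  have h0 : ∫⁻ u : Momentum, f u = ∫⁻ u in ({0}ᶜ : Set Momentum), f u := by
    rw [restrict_compl_singleton]
  rw [surfaceMeasure, ← h, h0, ← lintegral_subtype_comap (measurableSet_singleton _).compl]
  refine lintegral_congr fun u => ?_
  congr 1
  exact congrArg Subtype.val ((homeomorphUnitSphereProd Momentum).symm_apply_apply u).symm

/-- On each sphere centered at the origin, the two directions may be exchanged. -/
theorem lintegral_swap_direction {f : Momentum → Momentum → ENNReal}
    (hf : Measurable (Function.uncurry f)) :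
    ∫⁻ u, ∫⁻ ω : S2, f u (‖u‖ • (ω : Momentum)) ∂surfaceMeasure
      = ∫⁻ u, ∫⁻ ω : S2, f (‖u‖ • (ω : Momentum)) u ∂surfaceMeasure := by
  have hn : ∀ z : S2 × Ioi (0 : ℝ), ‖(z.2 : ℝ) • (z.1 : Momentum)‖ = z.2 := fun z => by
    rw [norm_smul, norm_eq_of_mem_sphere, mul_one, Real.norm_of_nonneg (le_of_lt z.2.2)]
  have hm : Measurable fun x : (S2 × Ioi (0 : ℝ)) × S2 =>
      f ((x.1.2 : ℝ) • (x.1.1 : Momentum)) ((x.1.2 : ℝ) • (x.2 : Momentum)) := by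
    have : Measurable fun x : (S2 × Ioi (0 : ℝ)) × S2 =>
      ((x.1.2 : ℝ) • (x.1.1 : Momentum), (x.1.2 : ℝ) • (x.2 : Momentum)) := by fun_prop
    exact hf.comp this
  have hm' : Measurable fun x : (S2 × Ioi (0 : ℝ)) × S2 =>
      f ((x.1.2 : ℝ) • (x.2 : Momentum)) ((x.1.2 : ℝ) • (x.1.1 : Momentum)) := by
    have : Measurable fun x : (S2 × Ioi (0 : ℝ)) × S2 =>
      ((x.1.2 : ℝ) • (x.2 : Momentum), (x.1.2 : ℝ) • (x.1.1 : Momentum)) := by fun_prop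
    exact hf.comp this
  rw [lintegral_polar, lintegral_polar]
  simp only [hn]
  -- With the radius outermost, Tonelli on `S2 × S2` exchanges the directions.
  rw [lintegral_prod_symm' _ hm.lintegral_prod_right', lintegral_prod_symm' _ hm'.lintegral_prod_right']
  refine lintegral_congr fun r => ?_
  have hr : Measurable fun x : S2 × S2 =>
      ((r : ℝ) • (x.1 : Momentum), (r : ℝ) • (x.2 : Momentum)) := by fun_prop
  exact lintegral_lintegral_swap (f := fun ω ω' : S2 =>
    f ((r : ℝ) • (ω : Momentum)) ((r : ℝ) • (ω' : Momentum))) (hf.comp hr).aemeasurable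

/-! ### Newtonian potential of the boosted sphere -/

theorem norm_le_norm_boost (P u v : Momentum) : ‖v‖ ≤ ‖boost P u v‖ := by
  refine le_of_sq_le_sq ?_ (norm_nonneg _)
  rw [norm_boost_sq]
  exact le_add_of_nonneg_right (sq_nonneg _)

theorem boost_sub (P u v w : Momentum) : boost P u (v - w) = boost P u v - boost P u w := by
  simp only [boost, inner_sub_right]
  module

theorem boost_surjective (P u : Momentum) : Function.Surjective (boost P u) := by
  let L : Momentum →ₗ[ℝ] Momentum :=
    { toFun := boost P u
      map_add' := fun v w => by simp only [boost, inner_add_right]; module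
      map_smul' := fun r v => boost_smul P u v r }
  refine (LinearMap.injective_iff_surjective (f := L)).1
    ((injective_iff_map_eq_zero L).2 fun v hv => ?_)
  have h : ‖v‖ ≤ ‖L v‖ := norm_le_norm_boost P u v
  rw [hv, norm_zero] at h
  exact norm_le_zero_iff.1 h

/-- The Newtonian potential of the ellipsoid of post-collisional momenta. -/
theorem lintegral_inv_dist_cmMap_le (P a : Momentum) {u : Momentum} (hu : u ≠ 0) :
    ∫⁻ ω : S2, ENNReal.ofReal (1 / ‖cmMap P (‖u‖ • (ω : Momentum)) - a‖) ∂surfaceMeasure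
      ≤ ENNReal.ofReal (1 / ‖u‖) * ENNReal.ofReal (220 * Real.pi) := by
  have hn : 0 < ‖u‖ := norm_pos_iff.2 hu
  -- Pulling `a` back to the rest frame makes the difference `|u|` times the boost of `ω - b`.
  obtain ⟨b, hb⟩ := boost_surjective P u (‖u‖⁻¹ • (a - (1 / 2 : ℝ) • P))
  refine le_trans ?_ (mul_le_mul_right (lintegral_sphere_inv_dist_le b) _)
  rw [← lintegral_const_mul' _ _ ENNReal.ofReal_ne_top]
  refine lintegral_mono fun ω => ?_
  have h : cmMap P (‖u‖ • (ω : Momentum)) - a = ‖u‖ • boost P u (ω - b) := by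
    rw [cmMap_norm_smul, boost_sub, hb, smul_sub, smul_inv_smul₀ hn.ne']
    abel
  rw [← ENNReal.ofReal_mul (by positivity), h, norm_smul, norm_norm, ← one_div_mul_one_div]
  rcases eq_or_ne ((ω : Momentum) - b) 0 with h0 | h0
  · simp [h0, boost]
  have hpos : 0 < ‖(ω : Momentum) - b‖ := norm_pos_iff.2 h0
  gcongr
  exact norm_le_norm_boost P u _

/-! ### Measurability -/

/-- The essential supremum is at most `c` exactly when the section of `{f > c}` is null, and
measures of sections are measurable in `y`. -/
theorem measurable_essSup_left {α β : Type*} [MeasurableSpace α] [MeasurableSpace β]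
    {μ : Measure α} [SFinite μ] {f : α → β → ENNReal} (hf : Measurable (Function.uncurry f)) :
    Measurable fun y => essSup (fun x => f x y) μ := by
  refine measurable_of_Iic fun c => ?_
  have h : (fun y => essSup (fun x => f x y) μ) ⁻¹' Set.Iic c
      = {y | μ ((fun x => (x, y)) ⁻¹' {z | c < Function.uncurry f z}) = 0} := by
    ext y
    simp only [Set.mem_preimage, Set.mem_Iic, Set.mem_ofPred_eq]
    constructor
    · intro hy
      have := (ENNReal.ae_le_essSup (μ := μ) fun x => f x y).mono fun x hx => hx.trans hy
      simp only [ae_iff, not_le] at this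
      exact this
    · intro hy
      refine essSup_le_of_ae_le c ?_
      rw [Filter.EventuallyLE, ae_iff]
      simp only [not_le]
      exact hy
  rw [h]
  exact measurable_measure_prodMk_right (measurableSet_lt measurable_const hf)
    (measurableSet_singleton 0)

theorem measurable_postP :
    Measurable fun z : (Momentum × Momentum) × S2 => postP z.1.1 z.1.2 z.2 := by
  unfold postP cmDir gammaCM relMom sInv lorentz energy
  fun_prop

theorem measurable_postQ :
    Measurable fun z : (Momentum × Momentum) × S2 => postQ z.1.1 z.1.2 z.2 := by
  unfold postQ cmDir gammaCM relMom sInv lorentz energy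
  fun_prop

theorem measurable_moller_mul_relMom :
    Measurable fun z : Momentum × Momentum => moller z.1 z.2 * relMom z.1 z.2 := by
  unfold moller relMom sInv lorentz energy
  fun_prop

theorem continuous_cmMap (P : Momentum) : Continuous (cmMap P) :=
  continuous_iff_continuousAt.2 fun u => (hasFDerivAt_cmMap P u).continuousAt

theorem measurable_totalEnergy (P : Momentum) : Measurable (totalEnergy P) := by
  unfold totalEnergy cmEnergy energy
  fun_prop

/-! ### The unweighted collision estimate -/

theorem lintegral_collision_cmMap_le {G : Momentum → ENNReal} (hG : Measurable G)
    (P a : Momentum) :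
    ∫⁻ p, ∫⁻ ω : S2, ENNReal.ofReal (1 / ‖p - a‖) *
        (ENNReal.ofReal (moller p (P - p) * relMom p (P - p))
          * (G (postP p (P - p) ω) * G (postQ p (P - p) ω))) ∂surfaceMeasure
      ≤ ENNReal.ofReal (1760 * Real.pi) * ∫⁻ p, G p * G (P - p) := by
  -- The kernel can be attached to the outgoing variable `v` because `|v| = |u|`; after the exchange
  -- only the potential still depends on `ω`.
  let f : Momentum → Momentum → ENNReal := fun u v => ENNReal.ofReal (1 / ‖cmMap P u - a‖) *
    (ENNReal.ofReal (16 * ‖v‖ ^ 2 / totalEnergy P v) * (G (cmMap P v) * G (P - cmMap P v)))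
  have hc := (continuous_cmMap P).measurable
  have hT := measurable_totalEnergy P
  have hf : Measurable (Function.uncurry f) := by
    simp only [f, Function.uncurry_def]
    fun_prop
  have h1 : ∀ u, ENNReal.ofReal (cmJacobian P u) *
      (∫⁻ ω : S2, ENNReal.ofReal (1 / ‖cmMap P u - a‖) *
        (ENNReal.ofReal (moller (cmMap P u) (P - cmMap P u) * relMom (cmMap P u) (P - cmMap P u))
          * (G (postP (cmMap P u) (P - cmMap P u) ω) * G (postQ (cmMap P u) (P - cmMap P u) ω)))
            ∂surfaceMeasure)
      = ∫⁻ ω : S2, f u (‖u‖ • (ω : Momentum)) ∂surfaceMeasure := fun u => by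
    rw [← lintegral_const_mul' _ _ ENNReal.ofReal_ne_top]
    refine lintegral_congr fun ω => ?_
    have hn : ‖‖u‖ • (ω : Momentum)‖ = ‖u‖ := by simp [norm_smul]
    simp only [f]
    rw [hn, totalEnergy_congr P hn, ← cmJacobian_mul_moller,
      ENNReal.ofReal_mul (cmJacobian_pos P u).le, postP_cmMap, postQ_cmMap]
    ring
  rw [lintegral_cmMap P, lintegral_congr h1, lintegral_swap_direction hf,
    lintegral_cmMap P fun p => G p * G (P - p), ← lintegral_const_mul' _ _ ENNReal.ofReal_ne_top]
  refine lintegral_mono fun u => ?_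
  simp only [f]
  rcases eq_or_ne u 0 with rfl | hu
  · simp
  have hn : 0 < ‖u‖ := norm_pos_iff.2 hu
  have hT0 := totalEnergy_pos P u
  rw [lintegral_mul_const _ (by fun_prop)]
  refine (mul_le_mul_left (lintegral_inv_dist_cmMap_le P a hu) _).trans ?_
  rw [← ENNReal.ofReal_mul (by positivity), ← mul_assoc,
    ← mul_assoc (ENNReal.ofReal (1760 * Real.pi)),
    ← ENNReal.ofReal_mul (by positivity), ← ENNReal.ofReal_mul (by positivity)]
  refine mul_le_mul_left (ENNReal.ofReal_le_ofReal ?_) _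
  -- Here `220 · 16 = 3520`, halved by `norm_div_totalEnergy_le`.
  calc 1 / ‖u‖ * (220 * Real.pi) * (16 * ‖u‖ ^ 2 / totalEnergy P u)
      = 3520 * Real.pi * (‖u‖ / totalEnergy P u) := by field_simp; norm_num
    _ ≤ 3520 * Real.pi * (cmJacobian P u / 2) := by
        have := norm_div_totalEnergy_le P u
        gcongr
    _ = 1760 * Real.pi * cmJacobian P u := by ring

/-- Bound of the gain operator with a Newtonian weight, without exponential weights. -/
theorem lintegral_collision_le {G : Momentum → ENNReal} (hG : Measurable G) (a : Momentum) :
    ∫⁻ p, ∫⁻ q, ∫⁻ ω : S2, ENNReal.ofReal (1 / ‖p - a‖) *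
        (ENNReal.ofReal (moller p q * relMom p q)
          * (G (postP p q ω) * G (postQ p q ω))) ∂surfaceMeasure
      ≤ ENNReal.ofReal (1760 * Real.pi) * (∫⁻ p, G p) ^ 2 := by
  let H : Momentum → Momentum → ENNReal := fun p q => ∫⁻ ω : S2, ENNReal.ofReal (1 / ‖p - a‖) *
        (ENNReal.ofReal (moller p q * relMom p q)
          * (G (postP p q ω) * G (postQ p q ω))) ∂surfaceMeasure
  have hH : Measurable (Function.uncurry H) := by
    have h1 := measurable_postP
    have h2 := measurable_postQ
    have h3 := measurable_moller_mul_relMom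
    refine Measurable.lintegral_prod_right' (f := fun z : (Momentum × Momentum) × S2 =>
      ENNReal.ofReal (1 / ‖z.1.1 - a‖) * (ENNReal.ofReal (moller z.1.1 z.1.2 * relMom z.1.1 z.1.2)
          * (G (postP z.1.1 z.1.2 z.2) * G (postQ z.1.1 z.1.2 z.2)))) ?_
    exact (by fun_prop : Measurable fun z : (Momentum × Momentum) × S2 =>
      ENNReal.ofReal (1 / ‖z.1.1 - a‖)).mul
        ((h3.comp measurable_fst).ennreal_ofReal.mul ((hG.comp h1).mul (hG.comp h2)))
  calc ∫⁻ p, ∫⁻ q, H p q = ∫⁻ p, ∫⁻ P, H p (P - p) :=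
        lintegral_congr fun p => (lintegral_sub_right_eq_self (H p) p).symm
    _ = ∫⁻ P, ∫⁻ p, H p (P - p) := by
        refine lintegral_lintegral_swap (f := fun p P => H p (P - p)) ?_
        have : Measurable fun z : Momentum × Momentum => (z.1, z.2 - z.1) := by fun_prop
        exact (hH.comp this).aemeasurable
    _ ≤ ∫⁻ P, ENNReal.ofReal (1760 * Real.pi) * ∫⁻ p, G p * G (P - p) :=
        lintegral_mono fun P => lintegral_collision_cmMap_le hG P a
    _ = ENNReal.ofReal (1760 * Real.pi) * ∫⁻ p, ∫⁻ P, G p * G (P - p) := by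
        rw [lintegral_const_mul' _ _ ENNReal.ofReal_ne_top,
          lintegral_lintegral_swap (f := fun P p => G p * G (P - p))]
        exact (by fun_prop : Measurable fun z : Momentum × Momentum =>
          G z.2 * G (z.1 - z.2)).aemeasurable
    _ = ENNReal.ofReal (1760 * Real.pi) * (∫⁻ p, G p) ^ 2 := by
        congr 1
        have h : ∀ p, ∫⁻ P, G p * G (P - p) = G p * ∫⁻ q, G q := fun p => by
          rw [lintegral_const_mul _ (by fun_prop), lintegral_sub_right_eq_self G p]
        rw [lintegral_congr h, lintegral_mul_const _ hG, sq]

/-! ### Essential suprema, kernel bound and exponential weights -/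

/-- `p ↦ ‖f(·, p)‖_{L^∞}`. -/
def envelope (f : unitInterval → Momentum → ℝ) (p : Momentum) : ENNReal :=
  essSup (fun x : unitInterval => ENNReal.ofReal |f x p|) volume

theorem measurable_envelope {f : unitInterval → Momentum → ℝ}
    (hf : Measurable (Function.uncurry f)) : Measurable (envelope f) :=
  measurable_essSup_left (f := fun x p => ENNReal.ofReal |f x p|)
    (continuous_abs.measurable.comp hf).ennreal_ofReal

theorem IsHardSphereKernel.le_mul {Λ : ℝ} {σ : ℝ → ℝ → ℝ} {σ₀ : ℝ → ℝ}
    (hσ : IsHardSphereKernel Λ σ σ₀) (hΛ : 0 ≤ Λ) (p q : Momentum) (ω : S2) :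
    σ (relMom p q) (scatAngle p q ω) ≤ Λ / (4 * Real.pi) * relMom p q := by
  have hθ : scatAngle p q ω ∈ Set.Icc 0 Real.pi := ⟨Real.arccos_nonneg _, Real.arccos_le_pi _⟩
  have hg : 0 ≤ relMom p q := Real.sqrt_nonneg _
  calc σ (relMom p q) (scatAngle p q ω) ≤ Λ * (relMom p q * σ₀ (scatAngle p q ω)) :=
        hσ.upper _ hg _ hθ
    _ ≤ Λ * (relMom p q * (1 / (4 * Real.pi))) := by
        have := hσ.angular_le _ hθ
        gcongr
    _ = Λ / (4 * Real.pi) * relMom p q := by ring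

/-- For almost every `x` the envelope dominates `f` at `p'` and `q'` for almost all `(q, ω)`, so the
supremum passes inside the collision integral. -/
theorem essSup_gain_le {Λ : ℝ} {σ : ℝ → ℝ → ℝ} {σ₀ : ℝ → ℝ}
    (hσ : IsHardSphereKernel Λ σ σ₀) (hΛ : 0 ≤ Λ) {f : unitInterval → Momentum → ℝ}
    (hf : Measurable (Function.uncurry f)) (hf0 : ∀ x p, 0 ≤ f x p) (p : Momentum) :
    essSup (fun x : unitInterval => gain σ f f x p) volume
      ≤ ENNReal.ofReal (Λ / (4 * Real.pi)) *
        ∫⁻ q, ∫⁻ ω : S2, ENNReal.ofReal (moller p q * relMom p q)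
          * (envelope f (postP p q ω) * envelope f (postQ p q ω)) ∂surfaceMeasure := by
  have hE := measurable_envelope hf
  have hpq : Measurable fun z : Momentum × S2 => ((p, z.1), z.2) := by fun_prop
  have hbound : ∀ {T : Momentum × S2 → Momentum}, Measurable T →
      ∀ᵐ x : unitInterval, ∀ᵐ q : Momentum, ∀ᵐ ω ∂surfaceMeasure,
        ENNReal.ofReal |f x (T (q, ω))| ≤ envelope f (T (q, ω)) := fun {T} hT => by
    have hT' : Measurable fun w : unitInterval × (Momentum × S2) => (w.1, T w.2) := by fun_prop
    have hm : MeasurableSet {w : unitInterval × (Momentum × S2) |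
        ENNReal.ofReal |f w.1 (T w.2)| ≤ envelope f (T w.2)} :=
      measurableSet_le (continuous_abs.measurable.comp (hf.comp hT')).ennreal_ofReal
        (hE.comp (hT.comp measurable_snd))
    -- The bound holds for every `(q, ω)` outside a null set of `x` depending on `(q, ω)`; Fubini
    -- exchanges the quantifiers. Starting from every `(q, ω)` avoids asking whether `T` pulls null
    -- sets back to null sets.
    have h := (Measure.ae_ae_comm (μ := (volume : Measure unitInterval))
      (ν := (volume : Measure Momentum).prod surfaceMeasure) hm).2
      (Filter.Eventually.of_forall fun z =>
        ENNReal.ae_le_essSup fun x => ENNReal.ofReal |f x (T z)|)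
    exact h.mono fun x hx => Measure.ae_ae_of_ae_prod hx
  refine essSup_le_of_ae_le _ ?_
  filter_upwards [hbound (measurable_postP.comp hpq), hbound (measurable_postQ.comp hpq)]
    with x hP hQ
  rw [gain, ← lintegral_const_mul' _ _ ENNReal.ofReal_ne_top]
  refine lintegral_mono_ae ?_
  filter_upwards [hP, hQ] with q hP hQ
  rw [← lintegral_const_mul' _ _ ENNReal.ofReal_ne_top]
  refine lintegral_mono_ae ?_
  filter_upwards [hP, hQ] with ω hP hQ
  simp only [Function.comp_apply, abs_of_nonneg (hf0 _ _)] at hP hQ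
  have hm := moller_nonneg p q
  have hg : 0 ≤ relMom p q := Real.sqrt_nonneg _
  have h1 := hf0 x (postP p q ω)
  have h2 := hf0 x (postQ p q ω)
  have hs := hσ.le_mul hΛ p q ω
  calc ENNReal.ofReal (moller p q * σ (relMom p q) (scatAngle p q ω)
        * f x (postP p q ω) * f x (postQ p q ω))
      ≤ ENNReal.ofReal (Λ / (4 * Real.pi) * ((moller p q * relMom p q)
        * (f x (postP p q ω) * f x (postQ p q ω)))) := by
        apply ENNReal.ofReal_le_ofReal
        calc _ ≤ moller p q * (Λ / (4 * Real.pi) * relMom p q)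
              * f x (postP p q ω) * f x (postQ p q ω) := by gcongr
          _ = _ := by ring
    _ = ENNReal.ofReal (Λ / (4 * Real.pi)) * (ENNReal.ofReal (moller p q * relMom p q)
          * (ENNReal.ofReal (f x (postP p q ω)) * ENNReal.ofReal (f x (postQ p q ω)))) := by
        rw [ENNReal.ofReal_mul (by positivity), ENNReal.ofReal_mul (by positivity),
          ENNReal.ofReal_mul h1]
    _ ≤ _ := by gcongr

/-- By energy conservation, `k p⁰ ≤ k (p⁰ + q⁰) = k (p'⁰ + q'⁰)`. -/
theorem weight_le_mul {k : ℝ} (hk : 0 ≤ k) (p q : Momentum) (ω : S2) :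
    weight k p ≤ weight k (postP p q ω) * weight k (postQ p q ω) := by
  rw [weight, weight, weight, ← Real.exp_add, ← mul_add, energy_post]
  have := energy_pos q
  gcongr
  linarith

end RelBoltzmann

end


theorem proposition3p1 (Λ : ℝ) (hΛ : 1 ≤ Λ) :
    ∃ C : ℝ, 0 < C ∧
      ∀ (σ : ℝ → ℝ → ℝ) (σ₀ : ℝ → ℝ), RelBoltzmann.IsHardSphereKernel Λ σ σ₀ →
      ∀ k : ℝ, 0 < k →
      ∀ f : unitInterval → RelBoltzmann.Momentum → ℝ,
        Measurable (Function.uncurry f) → (∀ x p, 0 ≤ f x p) →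
      ∀ a : RelBoltzmann.Momentum,
        ∫⁻ p : RelBoltzmann.Momentum,
            ENNReal.ofReal (RelBoltzmann.weight k p / ‖p - a‖)
              * essSup (fun x : unitInterval => RelBoltzmann.gain σ f f x p) volume
          ≤ ENNReal.ofReal C * RelBoltzmann.wnorm k f ^ 2 := by
  have hΛ0 : 0 < Λ := one_pos.trans_le hΛ
  -- The first factor bounds `σ / g`; the second is the constant of the unweighted estimate.
  refine ⟨Λ / (4 * Real.pi) * (1760 * Real.pi), by positivity, ?_⟩
  intro σ σ₀ hσ k hk f hf hf0 a
  let w : RelBoltzmann.Momentum → ENNReal := fun p => ENNReal.ofReal (RelBoltzmann.weight k p)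
  let G : RelBoltzmann.Momentum → ENNReal := fun p => RelBoltzmann.envelope f p * w p
  have hw0 : ∀ p, 0 ≤ RelBoltzmann.weight k p := fun p => (Real.exp_pos _).le
  have hw : Measurable w :=
    (Real.continuous_exp.comp (continuous_const.mul
      RelBoltzmann.continuous_energy)).measurable.ennreal_ofReal
  have hG : Measurable G := (RelBoltzmann.measurable_envelope hf).mul hw
  -- Of the factor `(p⁰)^{1/2}` in the norm, only that it is at least 1 is needed.
  have hGw : ∫⁻ p, G p ≤ RelBoltzmann.wnorm k f := by
    refine lintegral_mono fun p => mul_le_mul_right (ENNReal.ofReal_le_ofReal ?_) _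
    exact le_mul_of_one_le_left (hw0 p)
      (Real.one_le_sqrt.2 (RelBoltzmann.one_le_energy p))
  rw [ENNReal.ofReal_mul (by positivity), mul_assoc]
  refine le_trans ?_ (mul_le_mul_right ((RelBoltzmann.lintegral_collision_le hG a).trans
    (mul_le_mul_right (pow_le_pow_left' hGw 2) _)) _)
  rw [← lintegral_const_mul' _ _ ENNReal.ofReal_ne_top]
  refine lintegral_mono fun p => ?_
  refine (mul_le_mul_right (RelBoltzmann.essSup_gain_le hσ hΛ0.le hf hf0 p) _).trans ?_
  rw [mul_left_comm, ← lintegral_const_mul' _ _ ENNReal.ofReal_ne_top]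
  refine mul_le_mul_right (lintegral_mono fun q => ?_) _
  rw [← lintegral_const_mul' _ _ ENNReal.ofReal_ne_top]
  refine lintegral_mono fun ω => ?_
  have h : ENNReal.ofReal (RelBoltzmann.weight k p / ‖p - a‖)
      ≤ ENNReal.ofReal (1 / ‖p - a‖) *
        (w (RelBoltzmann.postP p q ω) * w (RelBoltzmann.postQ p q ω)) := by
    rw [← ENNReal.ofReal_mul (hw0 _), ← ENNReal.ofReal_mul (by positivity)]
    apply ENNReal.ofReal_le_ofReal
    rw [div_eq_mul_one_div, mul_comm]
    exact mul_le_mul_of_nonneg_left (RelBoltzmann.weight_le_mul hk.le p q ω) (by positivity)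
  refine (mul_le_mul_left h _).trans_eq ?_
  simp only [G]
  ring
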